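/- A \emph{graph} is a finite directed graph on the node set $\{1,\dots,n\}$; self-loops are allowed, parallel arcs are not. For $\alpha\in(0,1)$ the PageRank vector $P$ of an $n$-node graph $G$ is the unique solution of $P=\alpha P M+\frac{1-\alpha}{n}\mathbf 1$, where $M_{ij}=\frac1n$ if node $i$ has no children, and otherwise $M_{ij}=\frac1m$ or $0$ according to whether $j$ is or is not one of the $m$ children of $i$. A \emph{natural query} is a (possibly randomized) query that on a graph $G$ returns a possibly empty connected subgraph of $G$, and whose answer depends either solely on the nodes of $G$ and not on its arcs, or solely on the set of arcs (incoming and outgoing) at a single node given as input to the query. A \emph{Monte Carlo algorithm} is, for every $n$, a randomized procedure which receives two nodes of an unknown $n$-node graph, adaptively makes natural queries (at any node, with no bound on the computation between queries), and may halt and answer with a node. \textbf{Theorem 2.} For every $\alpha\in(0,1)$ and $\eta>0$ there are constants $c_\delta>0$ ($\delta>0$) such that the following holds. For every Monte Carlo algorithm employing only natural queries there exist, for arbitrarily large $n$, an $n$-node graph $G$ and two nodes $u,v$ of $G$ with $P(u)>(1+\eta)P(v)$ such that, for every $\delta>0$: if the algorithm, given $u$ and $v$ in uniformly random order, answers $u$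 (i.e. correctly determines that $P(u)>P(v)$) with probability at least $\frac12+\delta$, then the expected number of queries it makes is at least $c_\delta\, n^{2/3}$. That is, the algorithm must perform $\Omega(n^{2/3})$ queries in expectation to determine with probability $\frac12+\Omega(1)$ that $P(u)>P(v)$. -/

import Mathlib

open scoped ENNReal

namespace PageRankQueries

/-! ### PageRank -/

open Classical in
/-- The children of the node `x`: the heads of the arcs that leave `x`
(a self-loop makes `x` a child of itself). -/
noncomputable def children {n : ℕ} (G : Digraph (Fin n)) (x : Fin n) : Finset (Fin n) :=
  Finset.univ.filter (fun y => G.Adj x y)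

open Classical in
/-- The matrix `M` of the surfer that never makes a damping jump: from a dangling node it moves to
a uniformly random node, from any other node to a uniformly random child. -/
noncomputable def surferMatrix {n : ℕ} (G : Digraph (Fin n)) : Matrix (Fin n) (Fin n) ℝ :=
  Matrix.of fun i j =>
    if (children G i).card = 0 then (n : ℝ)⁻¹
    else if j ∈ children G i then ((children G i).card : ℝ)⁻¹ else 0

/-- The PageRank vector of `G` with damping factor `α`, i.e. the row vector
`((1 - α) / n) 𝟙 (1 - α M)⁻¹`. By `eq_pageRank_iff` it is, for `0 < α < 1`, the unique solution `P`
of `P = α P M + ((1 - α) / n) 𝟙`. -/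
noncomputable def pageRank {n : ℕ} (α : ℝ) (G : Digraph (Fin n)) : Fin n → ℝ :=
  Matrix.vecMul (fun _ => (1 - α) * (n : ℝ)⁻¹) (1 - α • surferMatrix G)⁻¹

theorem surferMatrix_nonneg {n : ℕ} (G : Digraph (Fin n)) (i j : Fin n) :
    0 ≤ surferMatrix G i j := by
  simp only [surferMatrix, Matrix.of_apply]
  split_ifs <;> positivity

theorem surferMatrix_row_sum {n : ℕ} (G : Digraph (Fin n)) (i : Fin n) :
    ∑ j, surferMatrix G i j = 1 := by
  have hn : (n : ℝ) ≠ 0 := by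
    have := i.pos
    positivity
  simp only [surferMatrix, Matrix.of_apply]
  by_cases h : (children G i).card = 0
  · simp [h, hn]
  · have h' : ((children G i).card : ℝ) ≠ 0 := by exact_mod_cast h
    simp only [h, if_false]
    rw [Finset.sum_ite_mem]
    simp [h']

theorem isUnit_det_one_sub_surferMatrix {n : ℕ} {α : ℝ} (h0 : 0 < α) (h1 : α < 1)
    (G : Digraph (Fin n)) : IsUnit (1 - α • surferMatrix G).det := by
  rw [isUnit_iff_ne_zero]
  apply det_ne_zero_of_sum_row_lt_diag
  intro k
  have hs := surferMatrix_row_sum G k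
  rw [← Finset.add_sum_erase _ _ (Finset.mem_univ k)] at hs
  have hk := surferMatrix_nonneg G k k
  have e : ∑ j ∈ Finset.univ.erase k, ‖(1 - α • surferMatrix G) k j‖
      = α * ∑ j ∈ Finset.univ.erase k, surferMatrix G k j := by
    rw [Finset.mul_sum]
    refine Finset.sum_congr rfl fun j hj => ?_
    have hj' : k ≠ j := (Finset.ne_of_mem_erase hj).symm
    simp [Matrix.sub_apply, Matrix.one_apply_ne hj', abs_of_pos h0,
      abs_of_nonneg (surferMatrix_nonneg G k j)]
  have d : (1 - α • surferMatrix G) k k = 1 - α * surferMatrix G k k := by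
    simp [Matrix.sub_apply]
  rw [e, d, Real.norm_eq_abs]
  refine lt_of_lt_of_le ?_ (le_abs_self _)
  nlinarith

/-- The PageRank vector is the unique solution of the PageRank equation. -/
theorem eq_pageRank_iff {n : ℕ} {α : ℝ} (h0 : 0 < α) (h1 : α < 1) (G : Digraph (Fin n))
    (P : Fin n → ℝ) :
    P = pageRank α G ↔
      P = α • Matrix.vecMul P (surferMatrix G) + fun _ => (1 - α) * (n : ℝ)⁻¹ := by
  have hu := isUnit_det_one_sub_surferMatrix h0 h1 G
  have key : P = α • Matrix.vecMul P (surferMatrix G) + (fun _ => (1 - α) * (n : ℝ)⁻¹) ↔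
      Matrix.vecMul P (1 - α • surferMatrix G) = fun _ => (1 - α) * (n : ℝ)⁻¹ := by
    rw [Matrix.vecMul_sub, Matrix.vecMul_one, Matrix.vecMul_smul, sub_eq_iff_eq_add, add_comm]
  rw [key, pageRank]
  constructor
  · rintro rfl
    rw [Matrix.vecMul_vecMul, Matrix.nonsing_inv_mul _ hu, Matrix.vecMul_one]
  · intro h
    rw [← h, Matrix.vecMul_vecMul, Matrix.mul_nonsing_inv _ hu, Matrix.vecMul_one]

/-! ### Natural exploration queries -/

/-- A directed graph on some of the node ids `0, …, n - 1`: what a query returns. -/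
@[ext]
structure Subdigraph (n : ℕ) where
  verts : Set (Fin n)
  Adj : Fin n → Fin n → Prop
  tail_mem : ∀ x y, Adj x y → x ∈ verts
  head_mem : ∀ x y, Adj x y → y ∈ verts

/-- All arcs of `H` are arcs of `G` (the nodes of `H` are nodes of `G` by typing). -/
def Subdigraph.IsSubgraphOf {n : ℕ} (H : Subdigraph n) (G : Digraph (Fin n)) : Prop :=
  ∀ x y, H.Adj x y → G.Adj x y

/-- `H` is empty or connected: any two of its nodes are joined by a path of arcs of `H`, each
traversed in either direction. -/
def Subdigraph.IsConnected {n : ℕ} (H : Subdigraph n) : Prop :=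
  ∀ x ∈ H.verts, ∀ y ∈ H.verts, Relation.EqvGen H.Adj x y

/-- `G` and `G'` have the same arcs (incoming and outgoing) at the node `x`. -/
def SameArcsAt {n : ℕ} (x : Fin n) (G G' : Digraph (Fin n)) : Prop :=
  ∀ y, (G.Adj x y ↔ G'.Adj x y) ∧ (G.Adj y x ↔ G'.Adj y x)

/-- A (possibly randomized) natural exploration query on `n`-node graphs. On the graph `G` it
returns a possibly empty connected subgraph of `G`, and its answer depends either solely on the
nodes of `G` but not on its arcs (global query), or solely on the arcs at a single node `x`, the
input of the query (local query). -/
structure NaturalQuery (n : ℕ) where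
  response : Digraph (Fin n) → PMF (Subdigraph n)
  subgraph : ∀ G, ∀ H ∈ (response G).support, H.IsSubgraphOf G ∧ H.IsConnected
  natural : (∀ G G', response G = response G') ∨
    ∃ x : Fin n, ∀ G G', SameArcsAt x G G' → response G = response G'

/-! ### Monte Carlo algorithms -/

/-- A randomized algorithm that receives an ordered pair of nodes of an unknown graph on the nodes
`0, …, n - 1` and explores the graph by natural queries. In each internal state it either halts with
a node as its answer (`Sum.inl`) or performs a natural query (`Sum.inr`); from the subgraph returned
it then moves to a random new state. There is no bound on the resources used between queries, and
the algorithm may halt after any (random) number of queries or never. -/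
structure MonteCarloAlgorithm (n : ℕ) where
  State : Type
  init : Fin n → Fin n → PMF State
  action : State → Fin n ⊕ NaturalQuery n
  update : State → Subdigraph n → PMF State

namespace MonteCarloAlgorithm

variable {n : ℕ}

/-- One step of the algorithm on the graph `G`: halted states stay, any other state makes its query
and moves on according to the answer. -/
noncomputable def step (A : MonteCarloAlgorithm n) (G : Digraph (Fin n)) (s : A.State) :
    PMF A.State :=
  match A.action s with
  | Sum.inl _ => PMF.pure s
  | Sum.inr q => (q.response G).bind (A.update s)

/-- The distribution of the state on input `(a, b)` after `t` steps. -/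
noncomputable def stateAfter (A : MonteCarloAlgorithm n) (G : Digraph (Fin n)) (a b : Fin n) :
    ℕ → PMF A.State
  | 0 => A.init a b
  | t + 1 => (stateAfter A G a b t).bind (A.step G)

/-- The probability that the algorithm on input `(a, b)` halts with answer `w`
(the probability of having done so after `t` steps is nondecreasing in `t`). -/
noncomputable def answerProb (A : MonteCarloAlgorithm n) (G : Digraph (Fin n)) (a b w : Fin n) :
    ℝ≥0∞ :=
  ⨆ t, (A.stateAfter G a b t).toOuterMeasure {s | A.action s = Sum.inl w}

/-- The expected number of queries on input `(a, b)`: the sum over all steps of the probability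
that a query is made in that step. It is `∞` if the algorithm runs forever with positive
probability. -/
noncomputable def queriesOn (A : MonteCarloAlgorithm n) (G : Digraph (Fin n)) (a b : Fin n) :
    ℝ≥0∞ :=
  ∑' t, (A.stateAfter G a b t).toOuterMeasure {s | ∃ q, A.action s = Sum.inr q}

/-- The probability that the algorithm answers `u` when the two nodes `u` and `v` are given to it
in uniformly random order. -/
noncomputable def successProb (A : MonteCarloAlgorithm n) (G : Digraph (Fin n)) (u v : Fin n) :
    ℝ≥0∞ :=
  (A.answerProb G u v u + A.answerProb G v u u) / 2

/-- The expected number of queries when the two nodes `u` and `v` are given to the algorithm in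
uniformly random order. -/
noncomputable def expectedQueries (A : MonteCarloAlgorithm n) (G : Digraph (Fin n))
    (u v : Fin n) : ℝ≥0∞ :=
  (A.queriesOn G u v + A.queriesOn G v u) / 2

end MonteCarloAlgorithm

end PageRankQueries

/-! The lower bound hides one local change among many. Take two roots, `m = 2 * t ^ 2` parents of
each, and `d = K * t` leaves per parent, so that `n` has order `t ^ 3`. In the base graph the roots
are symmetric. Reversing the arcs between one parent and its leaves lets that parent collect the
rank of its `d` leaves and pass all of it to its root, instead of a `1 / (d + 1)` share. This gain,
of order `t`, matches what the other root gets from its `m` parents, each contributing about `1 /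
d`; a large `K` makes the ratio exceed `1 + η` (`pageRank_hardGraph_gt`).

The roots see no difference, so each natural query separates the base graph from at most one of the
`m` modifications on a given side. Runs on two graphs have the same law up to the expected number of
separating queries (`expect_stateAfter_le_add_separation`). These numbers, summed over the
modifications, are at most the number of queries on the base graph (`sum_separation_le`). On the
base graph itself the answer carries no information: the probabilities of the two answers sum to at
most `1`. Averaging over both sides and all parents, the success probability exceeds `1 / 2` by at
most `2 / t ^ 2` times the mean expected number of queries (`mul_sum_successProb_le`). Some instance
is therefore hard, and `t ^ 2` has order `n ^ (2 / 3)`. -/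

namespace PageRankQueries

/-! ### Expectations under a `PMF` -/

/-- The expectation of `f` under `μ`. -/
noncomputable def expect {S : Type*} (μ : PMF S) (f : S → ℝ≥0∞) : ℝ≥0∞ := ∑' s, μ s * f s

section expect

variable {S R : Type*}

theorem expect_bind (μ : PMF S) (k : S → PMF R) (f : R → ℝ≥0∞) :
    expect (μ.bind k) f = expect μ fun s => expect (k s) f := by
  simp only [expect, PMF.bind_apply, ← ENNReal.tsum_mul_right, ← ENNReal.tsum_mul_left]
  rw [ENNReal.tsum_comm]
  simp only [mul_assoc]

theorem expect_pure (s : S) (f : S → ℝ≥0∞) : expect (PMF.pure s) f = f s := by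
  rw [expect, tsum_eq_single s]
  · simp
  · intro r hr
    simp [hr]

theorem expect_mono (μ : PMF S) {f g : S → ℝ≥0∞} (h : ∀ s, f s ≤ g s) :
    expect μ f ≤ expect μ g :=
  ENNReal.tsum_le_tsum fun s => by gcongr; exact h s

theorem expect_add (μ : PMF S) (f g : S → ℝ≥0∞) :
    expect μ (fun s => f s + g s) = expect μ f + expect μ g := by
  simp only [expect, mul_add, ENNReal.tsum_add]

theorem expect_sum {ι : Type*} (I : Finset ι) (μ : PMF S) (f : ι → S → ℝ≥0∞) :
    expect μ (fun s => ∑ i ∈ I, f i s) = ∑ i ∈ I, expect μ (f i) := by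
  classical
  induction I using Finset.induction_on with
  | empty => simp [expect]
  | insert i I hi ih => simp only [Finset.sum_insert hi, expect_add, ih]

theorem expect_one (μ : PMF S) : expect μ (fun _ => 1) = 1 := by
  simp [expect, μ.tsum_coe]

theorem toOuterMeasure_eq_expect (μ : PMF S) (s : Set S) :
    μ.toOuterMeasure s = expect μ (s.indicator 1) := by
  rw [PMF.toOuterMeasure_apply, expect]
  refine tsum_congr fun x => ?_
  by_cases h : x ∈ s <;> simp [h]

end expect

/-! ### Comparing the runs of one algorithm on two graphs -/

namespace MonteCarloAlgorithm

variable {n : ℕ} (A : MonteCarloAlgorithm n)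

/-- The states in which a query is made. -/
def querying : Set A.State := {s | ∃ q, A.action s = Sum.inr q}

/-- The states in which the algorithm has halted with answer `w`. -/
def answered (w : Fin n) : Set A.State := {s | A.action s = Sum.inl w}

/-- The states whose query is answered differently on `G` and on `G'`. -/
def separating (G G' : Digraph (Fin n)) : Set A.State :=
  {s | ∃ q, A.action s = Sum.inr q ∧ q.response G ≠ q.response G'}

theorem step_eq_pure {s : A.State} (hs : s ∉ A.querying) (G : Digraph (Fin n)) :
    A.step G s = PMF.pure s := by
  unfold step
  split
  · rfl
  · next q h => exact absurd ⟨q, h⟩ hs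

theorem step_eq_step {s : A.State} {G G' : Digraph (Fin n)} (hs : s ∉ A.separating G G') :
    A.step G s = A.step G' s := by
  unfold step
  split
  · rfl
  · next q h =>
    by_cases e : q.response G = q.response G'
    · rw [e]
    · exact absurd ⟨q, h, e⟩ hs

theorem expect_step_le {G G' : Digraph (Fin n)} {f : A.State → ℝ≥0∞} (hf : ∀ s, f s ≤ 1)
    (s : A.State) :
    expect (A.step G s) f ≤ expect (A.step G' s) f + (A.separating G G').indicator 1 s := by
  by_cases h : s ∈ A.separating G G'
  · simp only [h, Set.indicator_of_mem, Pi.one_apply]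
    calc _ ≤ expect (A.step G s) fun _ => 1 := expect_mono _ hf
      _ = 1 := expect_one _
      _ ≤ _ := le_add_self
  · rw [A.step_eq_step h]
    exact le_self_add

theorem separating_comm (G G' : Digraph (Fin n)) : A.separating G G' = A.separating G' G := by
  ext s
  simp only [separating, ne_comm]

/-- The expected number of the first `t` queries, on input `(a, b)` and graph `G`, that would be
answered differently on `G'`. -/
noncomputable def separation (G G' : Digraph (Fin n)) (a b : Fin n) (t : ℕ) : ℝ≥0∞ :=
  ∑ r ∈ Finset.range t, expect (A.stateAfter G a b r) ((A.separating G G').indicator 1)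

theorem separation_succ (G G' : Digraph (Fin n)) (a b : Fin n) (t : ℕ) :
    A.separation G G' a b (t + 1) = A.separation G G' a b t
      + expect (A.stateAfter G a b t) ((A.separating G G').indicator 1) :=
  Finset.sum_range_succ _ _

theorem separation_mono (G G' : Digraph (Fin n)) (a b : Fin n) :
    Monotone (A.separation G G' a b) := fun _ _ h =>
  Finset.sum_le_sum_of_subset (Finset.range_mono h)

theorem expect_step_mem_le_one {G : Digraph (Fin n)} {f : A.State → ℝ≥0∞} (hf : ∀ s, f s ≤ 1)
    (s : A.State) : expect (A.step G s) f ≤ 1 :=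
  (expect_mono _ hf).trans_eq (expect_one _)

/-- The step laws differ only at separating states. Here and in the primed version the error is
measured along the run on `G`; with `G` the base graph, a single run controls all modifications at
once. -/
theorem expect_stateAfter_le_add_separation (G G' : Digraph (Fin n)) (a b : Fin n) (t : ℕ)
    {f : A.State → ℝ≥0∞} (hf : ∀ s, f s ≤ 1) :
    expect (A.stateAfter G' a b t) f
      ≤ expect (A.stateAfter G a b t) f + A.separation G G' a b t := by
  induction t generalizing f with
  | zero => simp [stateAfter]
  | succ t ih =>
    simp only [stateAfter, expect_bind]
    -- Passing to the run on `G` before exchanging the last step charges that step's error to `G`;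
    -- the primed version needs the opposite order.
    refine (ih (A.expect_step_mem_le_one hf)).trans ?_
    rw [A.separation_succ, add_comm (A.separation G G' a b t), ← add_assoc, ← expect_add]
    gcongr
    refine expect_mono _ fun s => ?_
    rw [A.separating_comm]
    exact A.expect_step_le hf s

theorem expect_stateAfter_le_add_separation' (G G' : Digraph (Fin n)) (a b : Fin n) (t : ℕ)
    {f : A.State → ℝ≥0∞} (hf : ∀ s, f s ≤ 1) :
    expect (A.stateAfter G a b t) f
      ≤ expect (A.stateAfter G' a b t) f + A.separation G G' a b t := by
  induction t generalizing f with
  | zero => simp [stateAfter]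
  | succ t ih =>
    simp only [stateAfter, expect_bind]
    refine (expect_mono _ fun s => A.expect_step_le (G' := G') hf s).trans ?_
    rw [A.separation_succ, expect_add, ← add_assoc]
    gcongr
    exact ih (A.expect_step_mem_le_one hf)

theorem indicator_one_le_one {S : Type*} (s : Set S) (x : S) :
    s.indicator (1 : S → ℝ≥0∞) x ≤ 1 :=
  Set.indicator_apply_le' (fun _ => le_rfl) fun _ => zero_le_one

/-- Halted states stay: the probability of a set of halted states does not decrease. -/
theorem monotone_expect_halted (G : Digraph (Fin n)) (a b : Fin n) {s : Set A.State}
    (hs : Disjoint s A.querying) :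
    Monotone fun t => expect (A.stateAfter G a b t) (s.indicator 1) := by
  refine monotone_nat_of_le_succ fun t => ?_
  simp only [stateAfter, expect_bind]
  refine expect_mono _ fun x => ?_
  by_cases hx : x ∈ s
  · rw [A.step_eq_pure (Set.disjoint_left.1 hs hx), expect_pure]
  · simp [hx]

theorem expect_compl_add (G : Digraph (Fin n)) (a b : Fin n) (t : ℕ) (s : Set A.State) :
    expect (A.stateAfter G a b t) (sᶜ.indicator 1)
      + expect (A.stateAfter G a b t) (s.indicator 1) = 1 := by
  rw [← expect_add, ← expect_one (A.stateAfter G a b t)]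
  congr 1
  ext x
  by_cases h : x ∈ s <;> simp [h]

/-- The complement of a set of halted states has nonincreasing probability. -/
theorem antitone_expect_compl_halted (G : Digraph (Fin n)) (a b : Fin n) {s : Set A.State}
    (hs : Disjoint s A.querying) :
    Antitone fun t => expect (A.stateAfter G a b t) (sᶜ.indicator 1) := by
  intro t t' h
  have h1 := A.expect_compl_add G a b t s
  have h2 := A.expect_compl_add G a b t' s
  have hm := A.monotone_expect_halted G a b hs h
  have hfin : expect (A.stateAfter G a b t') (s.indicator 1) ≠ ∞ :=
    ne_top_of_le_ne_top ENNReal.one_ne_top (h2 ▸ le_add_self)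
  refine (ENNReal.add_le_add_iff_right hfin).1 ?_
  rw [h2, ← h1]
  gcongr

theorem antitone_expect_querying (G : Digraph (Fin n)) (a b : Fin n) :
    Antitone fun t => expect (A.stateAfter G a b t) (A.querying.indicator 1) := by
  simpa using A.antitone_expect_compl_halted G a b (s := A.queryingᶜ) disjoint_compl_left

/-- The expected number of queries among the first `t` steps. -/
noncomputable def queriesWithin (G : Digraph (Fin n)) (a b : Fin n) (t : ℕ) : ℝ≥0∞ :=
  ∑ r ∈ Finset.range t, expect (A.stateAfter G a b r) (A.querying.indicator 1)

theorem queriesWithin_le (G : Digraph (Fin n)) (a b : Fin n) (t : ℕ) :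
    A.queriesWithin G a b t ≤ A.queriesOn G a b := by
  simp only [queriesWithin, queriesOn, toOuterMeasure_eq_expect]
  exact ENNReal.sum_le_tsum _

theorem queriesWithin_ne_top (G : Digraph (Fin n)) (a b : Fin n) (t : ℕ) :
    A.queriesWithin G a b t ≠ ∞ := by
  refine ENNReal.sum_ne_top.2 fun r _ => ne_top_of_le_ne_top ENNReal.one_ne_top ?_
  exact (expect_mono _ (indicator_one_le_one _)).trans_eq (expect_one _)

/-- Markov's inequality: the probability of still running is nonincreasing, so its last value is
below each of the `t` summands. -/
theorem mul_expect_querying_le (G : Digraph (Fin n)) (a b : Fin n) (t : ℕ) :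
    t * expect (A.stateAfter G a b t) (A.querying.indicator 1) ≤ A.queriesWithin G a b t := by
  have := Finset.card_nsmul_le_sum (Finset.range t)
    (fun r => expect (A.stateAfter G a b r) (A.querying.indicator 1))
    (expect (A.stateAfter G a b t) (A.querying.indicator 1))
    (fun r hr => A.antitone_expect_querying G a b (Finset.mem_range.1 hr).le)
  simpa [nsmul_eq_mul, queriesWithin] using this

theorem disjoint_answered (w : Fin n) : Disjoint (A.answered w) A.querying := by
  refine Set.disjoint_left.2 fun s h => ?_
  rintro ⟨q, hq⟩
  simp only [answered, Set.mem_ofPred_eq] at h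
  simp [h] at hq

/-- An answer is given within `t` steps, unless the algorithm is still running. -/
theorem answerProb_le (G : Digraph (Fin n)) (a b w : Fin n) (t : ℕ) :
    A.answerProb G a b w ≤ expect (A.stateAfter G a b t) ((A.answered w).indicator 1)
      + expect (A.stateAfter G a b t) (A.querying.indicator 1) := by
  refine iSup_le fun r => ?_
  rw [toOuterMeasure_eq_expect]
  refine (A.monotone_expect_halted G a b (A.disjoint_answered w) (le_max_left r t)).trans ?_
  have hd : Disjoint (A.answered w ∪ A.querying)ᶜ A.querying :=
    disjoint_compl_left.mono_right Set.subset_union_right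
  have h := A.antitone_expect_compl_halted G a b hd (le_max_right r t)
  simp only [compl_compl] at h
  calc _ ≤ expect (A.stateAfter G a b (max r t))
        ((A.answered w ∪ A.querying).indicator 1) :=
        expect_mono _ fun s => Set.indicator_le_indicator_of_subset Set.subset_union_left
          (fun _ => zero_le_one) s
    _ ≤ _ := h
    _ = _ := by
      rw [← expect_add, Set.indicator_union_of_disjoint (A.disjoint_answered w)]

/-- The probabilities of two different answers add up to at most `1`. -/
theorem expect_answered_add_le_one (G : Digraph (Fin n)) (a b : Fin n) (t : ℕ) {v w : Fin n}
    (h : v ≠ w) :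
    expect (A.stateAfter G a b t) ((A.answered v).indicator 1)
      + expect (A.stateAfter G a b t) ((A.answered w).indicator 1) ≤ 1 := by
  rw [← expect_add, ← expect_one (A.stateAfter G a b t)]
  have hd : Disjoint (A.answered v) (A.answered w) := by
    refine Set.disjoint_left.2 fun s h1 h2 => h ?_
    simp only [answered, Set.mem_ofPred_eq] at h1 h2
    exact Sum.inl_injective (h1.symm.trans h2)
  refine expect_mono _ fun s => ?_
  have := indicator_one_le_one (A.answered v ∪ A.answered w) s
  rwa [Set.indicator_union_of_disjoint hd] at this

/-! ### A graph hidden among local modifications of another graph -/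

section hidden

variable {ι : Type*} [Fintype ι] {G₀ : Digraph (Fin n)} {G : ι → Digraph (Fin n)}

/-- A global query separates nothing. A local query at `x` separates only graphs that change the
arcs at `x`, of which there is at most one. -/
theorem sum_indicator_separating_le
    (hG : ∀ x i j, ¬ SameArcsAt x G₀ (G i) → ¬ SameArcsAt x G₀ (G j) → i = j) (s : A.State) :
    ∑ i, (A.separating G₀ (G i)).indicator (1 : A.State → ℝ≥0∞) s
      ≤ A.querying.indicator 1 s := by
  classical
  by_cases hex : ∃ i, s ∈ A.separating G₀ (G i)
  · obtain ⟨i, q, hq, hi⟩ := hex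
    have huniq : ∀ j, j ≠ i → s ∉ A.separating G₀ (G j) := by
      rintro j hji ⟨q', hq', hj⟩
      obtain rfl : q = q' := Sum.inr_injective (hq.symm.trans hq')
      rcases q.natural with hc | ⟨x, hx⟩
      · exact hi (hc _ _)
      · exact hji (hG x j i (fun h => hj (hx _ _ h)) fun h => hi (hx _ _ h))
    rw [Finset.sum_eq_single i (fun j _ hj => by simp [huniq j hj]) (by simp)]
    have : s ∈ A.querying := ⟨q, hq⟩
    simpa [this] using indicator_one_le_one _ s
  · push Not at hex
    simp [hex]

theorem sum_separation_le
    (hG : ∀ x i j, ¬ SameArcsAt x G₀ (G i) → ¬ SameArcsAt x G₀ (G j) → i = j)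
    (a b : Fin n) (t : ℕ) :
    ∑ i, A.separation G₀ (G i) a b t ≤ A.queriesWithin G₀ a b t := by
  simp only [separation, queriesWithin]
  rw [Finset.sum_comm]
  refine Finset.sum_le_sum fun r _ => ?_
  rw [← expect_sum]
  exact expect_mono _ (A.sum_indicator_separating_le hG)

/-- The algorithm could be slow on `G₀` alone, whereas only the costs on the modified graphs are to
be bounded below; this transfers the cost. -/
theorem queriesWithin_le_add_separation (G₀ G : Digraph (Fin n)) (a b : Fin n) (t : ℕ) :
    A.queriesWithin G₀ a b t ≤ A.queriesWithin G a b t + t * A.separation G₀ G a b t := by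
  have : (t : ℝ≥0∞) * A.separation G₀ G a b t
      = ∑ _r ∈ Finset.range t, A.separation G₀ G a b t := by simp
  rw [this, queriesWithin, queriesWithin, ← Finset.sum_add_distrib]
  refine Finset.sum_le_sum fun r hr => ?_
  refine (A.expect_stateAfter_le_add_separation' G₀ G a b r (indicator_one_le_one _)).trans ?_
  gcongr
  exact A.separation_mono _ _ _ _ (Finset.mem_range.1 hr).le

/-- Summed over all `2 * t` graphs, the transfer error is at most `t` times the cost on `G₀`, which
is half of the left side. Having twice as many graphs as steps lets it be absorbed. -/
theorem mul_queriesWithin_le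
    (hG : ∀ x i j, ¬ SameArcsAt x G₀ (G i) → ¬ SameArcsAt x G₀ (G j) → i = j)
    (a b : Fin n) (t : ℕ) (ht : Fintype.card ι = 2 * t) :
    t * A.queriesWithin G₀ a b t ≤ ∑ i, A.queriesWithin (G i) a b t := by
  have h := Finset.sum_le_sum fun i (_ : i ∈ Finset.univ) =>
    A.queriesWithin_le_add_separation G₀ (G i) a b t
  rw [Finset.sum_add_distrib, ← Finset.mul_sum, Finset.sum_const, Finset.card_univ, ht,
    nsmul_eq_mul] at h
  have h2 := h.trans (add_le_add_right (mul_le_mul_right (A.sum_separation_le hG a b t) (t : ℝ≥0∞)) _)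
  -- Cancellation needs a finite cost, which truncation at `t` steps guarantees.
  have hfin : (t : ℝ≥0∞) * A.queriesWithin G₀ a b t ≠ ∞ :=
    ENNReal.mul_ne_top (ENNReal.natCast_ne_top t) (A.queriesWithin_ne_top _ _ _ _)
  refine (ENNReal.add_le_add_iff_right hfin).1 (le_trans (le_of_eq ?_) h2)
  push_cast
  ring

/-- Two errors arise: replacing `G i` by `G₀` during the first `t` steps, and runs on `G i` that
have not halted by then. After multiplication by `t`, each totals at most the sum of the query
costs. -/
theorem mul_sum_answerProb_le
    (hG : ∀ x i j, ¬ SameArcsAt x G₀ (G i) → ¬ SameArcsAt x G₀ (G j) → i = j)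
    (a b w : Fin n) (t : ℕ) (ht : Fintype.card ι = 2 * t) :
    t * ∑ i, A.answerProb (G i) a b w
      ≤ 2 * t ^ 2 * expect (A.stateAfter G₀ a b t) ((A.answered w).indicator 1)
        + 2 * ∑ i, A.queriesOn (G i) a b := by
  have h1 : ∀ i, A.answerProb (G i) a b w
      ≤ expect (A.stateAfter G₀ a b t) ((A.answered w).indicator 1)
        + A.separation G₀ (G i) a b t
        + expect (A.stateAfter (G i) a b t) (A.querying.indicator 1) := fun i =>
    (A.answerProb_le (G i) a b w t).trans <| by
      gcongr
      exact A.expect_stateAfter_le_add_separation _ _ _ _ _ (indicator_one_le_one _)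
  have h2 := Finset.sum_le_sum fun i (_ : i ∈ Finset.univ) => h1 i
  simp only [Finset.sum_add_distrib, Finset.sum_const, Finset.card_univ, ht, nsmul_eq_mul] at h2
  have hq : ∑ i, A.queriesWithin (G i) a b t ≤ ∑ i, A.queriesOn (G i) a b :=
    Finset.sum_le_sum fun i _ => A.queriesWithin_le _ _ _ _
  have h3 : (t : ℝ≥0∞) * ∑ i, A.separation G₀ (G i) a b t ≤ ∑ i, A.queriesOn (G i) a b :=
    (mul_le_mul_right (A.sum_separation_le hG a b t) _).trans
      ((A.mul_queriesWithin_le hG a b t ht).trans hq)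
  have h4 : (t : ℝ≥0∞) * ∑ i, expect (A.stateAfter (G i) a b t) (A.querying.indicator 1)
      ≤ ∑ i, A.queriesOn (G i) a b := by
    rw [Finset.mul_sum]
    exact (Finset.sum_le_sum fun i _ => A.mul_expect_querying_le _ _ _ _).trans hq
  calc _ ≤ _ := mul_le_mul_right h2 (t : ℝ≥0∞)
    _ = 2 * t ^ 2 * expect (A.stateAfter G₀ a b t) ((A.answered w).indicator 1)
        + (t * ∑ i, A.separation G₀ (G i) a b t
        + t * ∑ i, expect (A.stateAfter (G i) a b t) (A.querying.indicator 1)) := by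
      push_cast
      ring
    _ ≤ _ := by
      rw [two_mul (∑ i, A.queriesOn (G i) a b)]
      gcongr

end hidden

/-- If, on each side `s`, the graphs `G s i` are local modifications of the graph `G₀`, each node
being affected by at most one of them, then few queries give little advantage over guessing at
telling the sides apart. -/
theorem mul_sum_successProb_le {ι : Type*} [Fintype ι] {G₀ : Digraph (Fin n)}
    {G : Bool → ι → Digraph (Fin n)}
    (hG : ∀ s x i j, ¬ SameArcsAt x G₀ (G s i) → ¬ SameArcsAt x G₀ (G s j) → i = j)
    (r : Bool → Fin n) (hr : r false ≠ r true) (t : ℕ) (ht : Fintype.card ι = 2 * t) :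
    t * ∑ s, ∑ i, A.successProb (G s i) (r s) (r !s)
      ≤ 2 * t ^ 2 + 2 * ∑ s, ∑ i, A.expectedQueries (G s i) (r s) (r !s) := by
  have key := fun s a b w => A.mul_sum_answerProb_le (hG s) a b w t ht
  -- For each input order, the correct answers of the two sides exclude each other on the common
  -- graph `G₀`.
  have o1 := A.expect_answered_add_le_one G₀ (r false) (r true) t hr
  have o2 := A.expect_answered_add_le_one G₀ (r true) (r false) t hr.symm
  have k1 := key false (r false) (r true) (r false)
  have k2 := key false (r true) (r false) (r false)
  have k3 := key true (r false) (r true) (r true)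
  have k4 := key true (r true) (r false) (r true)
  have k := add_le_add (add_le_add k1 k2) (add_le_add k3 k4)
  have o := mul_le_mul_right (add_le_add o1 o2) (2 * (t : ℝ≥0∞) ^ 2)
  have half : ∀ f g : ι → ℝ≥0∞, 2 * ∑ i, (f i + g i) / 2 = ∑ i, f i + ∑ i, g i := fun f g => by
    rw [Finset.mul_sum, ← Finset.sum_add_distrib]
    exact Finset.sum_congr rfl fun i _ =>
      ENNReal.mul_div_cancel two_ne_zero ENNReal.ofNat_ne_top
  have e1 : 2 * (t * ∑ s, ∑ i, A.successProb (G s i) (r s) (r !s))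
      = t * ∑ i, A.answerProb (G false i) (r false) (r true) (r false)
      + t * ∑ i, A.answerProb (G false i) (r true) (r false) (r false)
      + (t * ∑ i, A.answerProb (G true i) (r false) (r true) (r true)
      + t * ∑ i, A.answerProb (G true i) (r true) (r false) (r true)) := by
    simp only [successProb, Fintype.sum_bool, Bool.not_true, Bool.not_false]
    rw [mul_left_comm, mul_add, half, half]
    ring
  have e2 : 2 * ∑ s, ∑ i, A.expectedQueries (G s i) (r s) (r !s)
      = ∑ i, A.queriesOn (G false i) (r false) (r true)
      + ∑ i, A.queriesOn (G false i) (r true) (r false)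
      + (∑ i, A.queriesOn (G true i) (r false) (r true)
      + ∑ i, A.queriesOn (G true i) (r true) (r false)) := by
    simp only [expectedQueries, Fintype.sum_bool, Bool.not_true, Bool.not_false]
    rw [mul_add, half, half]
    ring
  refine (ENNReal.mul_le_mul_iff_right two_ne_zero ENNReal.ofNat_ne_top).1 ?_
  rw [e1]
  refine k.trans ?_
  calc _ = 2 * t ^ 2 *
          (expect (A.stateAfter G₀ (r false) (r true) t) ((A.answered (r false)).indicator 1)
          + expect (A.stateAfter G₀ (r false) (r true) t) ((A.answered (r true)).indicator 1)
          + (expect (A.stateAfter G₀ (r true) (r false) t) ((A.answered (r true)).indicator 1)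
          + expect (A.stateAfter G₀ (r true) (r false) t) ((A.answered (r false)).indicator 1)))
        + 2 * (∑ i, A.queriesOn (G false i) (r false) (r true)
          + ∑ i, A.queriesOn (G false i) (r true) (r false)
          + (∑ i, A.queriesOn (G true i) (r false) (r true)
          + ∑ i, A.queriesOn (G true i) (r true) (r false))) := by ring
    _ ≤ _ := add_le_add_left o _
    _ = _ := by rw [← e2]; ring

end MonteCarloAlgorithm

/-! ### PageRank as a multiple of the contribution of uniform jumps -/

theorem pageRank_apply {n : ℕ} {α : ℝ} (h0 : 0 < α) (h1 : α < 1) (G : Digraph (Fin n))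
    (x : Fin n) :
    pageRank α G x = α * ∑ y, pageRank α G y * surferMatrix G y x + (1 - α) * (n : ℝ)⁻¹ := by
  have h := congrFun ((eq_pageRank_iff h0 h1 G _).1 rfl) x
  simpa [Matrix.vecMul, dotProduct] using h

theorem sum_pageRank {n : ℕ} [NeZero n] {α : ℝ} (h0 : 0 < α) (h1 : α < 1)
    (G : Digraph (Fin n)) : ∑ x, pageRank α G x = 1 := by
  have h := Finset.sum_congr rfl fun x (_ : x ∈ Finset.univ) => pageRank_apply h0 h1 G x
  have hn : (n : ℝ) ≠ 0 := Nat.cast_ne_zero.2 (NeZero.ne n)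
  rw [Finset.sum_add_distrib, ← Finset.mul_sum, Finset.sum_comm] at h
  simp only [← Finset.mul_sum, surferMatrix_row_sum, mul_one, Finset.sum_const, Finset.card_univ,
    Fintype.card_fin, nsmul_eq_mul] at h
  field_simp at h
  have : (1 - α) * ∑ x, pageRank α G x = (1 - α) * 1 := by linarith
  exact mul_left_cancel₀ (sub_ne_zero.2 h1.ne') this

/-- Absolute values satisfy the PageRank equation as an inequality. Summing gives total absolute
mass at most `1`, the sum of the entries themselves, so no entry is negative. -/
theorem pageRank_nonneg {n : ℕ} {α : ℝ} (h0 : 0 < α) (h1 : α < 1) (G : Digraph (Fin n))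
    (x : Fin n) : 0 ≤ pageRank α G x := by
  have : NeZero n := ⟨x.pos.ne'⟩
  have hn : (n : ℝ) ≠ 0 := Nat.cast_ne_zero.2 (NeZero.ne n)
  have habs : ∀ x, |pageRank α G x|
      ≤ α * ∑ y, |pageRank α G y| * surferMatrix G y x + (1 - α) * (n : ℝ)⁻¹ := by
    intro x
    rw [pageRank_apply h0 h1 G x]
    have hc : 0 ≤ (1 - α) * (n : ℝ)⁻¹ := mul_nonneg (by linarith) (by positivity)
    refine (abs_add_le _ _).trans ?_
    rw [abs_of_nonneg hc, abs_mul, abs_of_pos h0]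
    gcongr
    refine (Finset.abs_sum_le_sum_abs _ _).trans_eq ?_
    simp only [abs_mul, abs_of_nonneg (surferMatrix_nonneg G _ _)]
  have h := Finset.sum_le_sum fun x (_ : x ∈ Finset.univ) => habs x
  rw [Finset.sum_add_distrib, ← Finset.mul_sum, Finset.sum_comm] at h
  simp only [← Finset.mul_sum, surferMatrix_row_sum, mul_one, Finset.sum_const, Finset.card_univ,
    Fintype.card_fin, nsmul_eq_mul] at h
  field_simp at h
  have hle : ∑ x, |pageRank α G x| ≤ 1 := by
    have : (1 - α) * ∑ x, |pageRank α G x| ≤ (1 - α) * 1 := by linarith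
    exact le_of_mul_le_mul_left this (by linarith)
  have hz : ∑ x, (|pageRank α G x| - pageRank α G x) = 0 := by
    refine le_antisymm ?_ (Finset.sum_nonneg fun x _ => sub_nonneg.2 (le_abs_self _))
    rw [Finset.sum_sub_distrib, sum_pageRank h0 h1]
    linarith
  have := (Finset.sum_eq_zero_iff_of_nonneg
    fun x _ => sub_nonneg.2 (le_abs_self (pageRank α G x))).1 hz x (Finset.mem_univ x)
  exact abs_eq_self.1 (by linarith)

/-- The damping jumps and the jumps from dangling nodes give every node the same positive amount of
PageRank; the rest is passed along the arcs. -/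
theorem exists_pageRank_eq {n : ℕ} [NeZero n] {α : ℝ} (h0 : 0 < α) (h1 : α < 1)
    (G : Digraph (Fin n)) :
    ∃ b > 0, ∀ x, pageRank α G x = b + α * ∑ y, if x ∈ children G y then
      pageRank α G y * ((children G y).card : ℝ)⁻¹ else 0 := by
  have hn : (0 : ℝ) < n := Nat.cast_pos.2 (NeZero.pos n)
  have h1' : 0 < 1 - α := by linarith
  refine ⟨(1 - α) * (n : ℝ)⁻¹ + α * ∑ y, if (children G y).card = 0 then
    pageRank α G y * (n : ℝ)⁻¹ else 0, ?_, fun x => ?_⟩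
  · refine add_pos_of_pos_of_nonneg (by positivity) (mul_nonneg h0.le
      (Finset.sum_nonneg fun y _ => ?_))
    split_ifs
    · exact mul_nonneg (pageRank_nonneg h0 h1 G y) (by positivity)
    · exact le_rfl
  · rw [pageRank_apply h0 h1 G x, add_assoc, ← mul_add, ← Finset.sum_add_distrib, add_comm]
    congr 2
    refine Finset.sum_congr rfl fun y _ => ?_
    by_cases hc : children G y = ∅
    · simp [surferMatrix, hc]
    · by_cases hx : x ∈ children G y <;> simp [surferMatrix, hc, hx]

/-! ### The hard instances -/

/-- The nodes of the hard instances: two roots, `m` parents of each of them, and `d` leaves at each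
parent. -/
abbrev Node (m d : ℕ) : Type := Bool ⊕ (Bool × Fin m) ⊕ (Bool × Fin m) × Fin d

/-- Each parent has an arc to its root and arcs to its leaves, but the arcs between the parent `θ`
(if any) and its leaves are reversed. -/
def Arc {m d : ℕ} (θ : Option (Bool × Fin m)) : Node m d → Node m d → Prop
  | .inr (.inl p), .inl s => p.1 = s
  | .inr (.inl p), .inr (.inr q) => p = q.1 ∧ θ ≠ some p
  | .inr (.inr q), .inr (.inl p) => p = q.1 ∧ θ = some p
  | _, _ => False

/-- The hard instance with the arcs `Arc θ`, on the nodes `0, …, n - 1`. -/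
noncomputable def hardGraph (m d : ℕ) (θ : Option (Bool × Fin m)) :
    Digraph (Fin (Fintype.card (Node m d))) where
  Adj x y := Arc θ ((Fintype.equivFin _).symm x) ((Fintype.equivFin _).symm y)

/-- The node of a hard instance that has the given description. -/
noncomputable def node {m d : ℕ} (z : Node m d) : Fin (Fintype.card (Node m d)) :=
  Fintype.equivFin _ z

variable {m d : ℕ}

theorem node_injective : Function.Injective (node : Node m d → _) :=
  (Fintype.equivFin _).injective

theorem mem_children_hardGraph (θ : Option (Bool × Fin m)) (z w : Node m d) :
    node w ∈ children (hardGraph m d θ) (node z) ↔ Arc θ z w := by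
  simp only [children, Finset.mem_filter_univ]
  simp [hardGraph, node]

theorem sum_ite_eq_fst {A B M : Type*} [Fintype A] [Fintype B] [DecidableEq A] [AddCommMonoid M]
    (a : A) (f : A × B → M) : (∑ q : A × B, if a = q.1 then f q else 0) = ∑ b, f (a, b) := by
  rw [Fintype.sum_prod_type, Finset.sum_eq_single a]
  · simp
  · intro c _ hc
    simp [hc.symm]
  · simp

open Classical in
theorem card_children_hardGraph (θ : Option (Bool × Fin m)) (z : Node m d) :
    (children (hardGraph m d θ) (node z)).card = ∑ w, if Arc θ z w then 1 else 0 := by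
  rw [← Finset.card_filter, ← Finset.card_map (Fintype.equivFin (Node m d)).toEmbedding]
  congr 1
  ext x
  obtain ⟨w, rfl⟩ := (Fintype.equivFin (Node m d)).surjective x
  have := mem_children_hardGraph θ z w
  simp only [node] at this
  simp [this, node]

theorem card_children_parent (p : Bool × Fin m) (θ : Option (Bool × Fin m)) :
    (children (hardGraph m d θ) (node (.inr (.inl p)))).card
      = if θ = some p then 1 else d + 1 := by
  rw [card_children_hardGraph]
  simp only [Fintype.sum_sum_type, Arc]
  by_cases h : θ = some p
  · rcases p with ⟨_ | _, i⟩ <;> simp [h]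
  · simp only [h, ne_eq, not_false_eq_true, and_true]
    rw [sum_ite_eq_fst]
    rcases p with ⟨_ | _, i⟩ <;> simp [add_comm]

theorem card_children_leaf (p : Bool × Fin m) (j : Fin d) :
    (children (hardGraph m d (some p)) (node (.inr (.inr (p, j))))).card = 1 := by
  rw [card_children_hardGraph]
  simp only [Fintype.sum_sum_type, Arc]
  simp [eq_comm]

/-- The parent to which a node that is not a root belongs. -/
def Node.parent? : Node m d → Option (Bool × Fin m)
  | .inl _ => none
  | .inr (.inl p) => some p
  | .inr (.inr q) => some q.1

/-- Only the parent `p` and its leaves see that their arcs are reversed. -/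
theorem sameArcsAt_hardGraph {p : Bool × Fin m} {z : Node m d} (h : Node.parent? z ≠ some p) :
    SameArcsAt (node z) (hardGraph m d none) (hardGraph m d (some p)) := by
  intro y
  obtain ⟨w, rfl⟩ := (Fintype.equivFin (Node m d)).surjective y
  simp only [hardGraph, node, Equiv.symm_apply_apply]
  rcases z with s | q | ⟨q, j⟩ <;> rcases w with s' | q' | ⟨q', j'⟩ <;>
    simp [Arc, Node.parent?] at h ⊢ <;> grind

/-- No arc enters an unreversed parent or a leaf of the reversed one, so these have exactly the base
rank `b`. Since `b` is common to all nodes, it need not be computed to compare the roots. -/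
theorem pageRank_hardGraph {α : ℝ} (h0 : 0 < α) (h1 : α < 1) (s : Bool) (i : Fin m) :
    ∃ b > 0,
      pageRank α (hardGraph m d (some (s, i))) (node (.inl s))
        = b + α * ((b + α * (d * b)) + (m - 1) * (b / (d + 1))) ∧
      pageRank α (hardGraph m d (some (s, i))) (node (.inl !s)) = b + α * (m * (b / (d + 1))) := by
  have : NeZero (Fintype.card (Node m d)) := ⟨Fintype.card_ne_zero⟩
  obtain ⟨b, hb, hP⟩ := exists_pageRank_eq h0 h1 (hardGraph m d (some (s, i)))
  refine ⟨b, hb, ?_⟩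
  set P : Node m d → ℝ := fun z => pageRank α (hardGraph m d (some (s, i))) (node z) with hPdef
  classical
  have hz : ∀ z, P z = b + α * ∑ y, if Arc (some (s, i)) y z then
      P y * ((children (hardGraph m d (some (s, i))) (node y)).card : ℝ)⁻¹ else 0 := by
    intro z
    simp only [hPdef]
    rw [hP, ← Equiv.sum_comp (Fintype.equivFin (Node m d))]
    simp only [← mem_children_hardGraph]
    rfl
  have hleaf : ∀ j, P (.inr (.inr ((s, i), j))) = b := fun j => by
    rw [hz, Finset.sum_eq_zero, mul_zero, add_zero]
    rintro (r | p | q) - <;> simp [Arc, eq_comm]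
  have hparent : ∀ p, p ≠ (s, i) → P (.inr (.inl p)) = b := fun p hp => by
    rw [hz, Finset.sum_eq_zero, mul_zero, add_zero]
    rintro (r | p | q) - <;> simp [Arc, hp.symm]
  have hspecial : P (.inr (.inl (s, i))) = b + α * (d * b) := by
    rw [hz]
    simp only [Fintype.sum_sum_type, Arc, and_true]
    rw [sum_ite_eq_fst]
    simp [card_children_leaf, hleaf]
  have hroot : ∀ r, P (.inl r) = b + α * ∑ k, P (.inr (.inl (r, k))) *
      ((if (s, i) = (r, k) then 1 else d + 1 : ℕ) : ℝ)⁻¹ := fun r => by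
    rw [hz]
    simp only [Fintype.sum_sum_type, Arc, card_children_parent]
    simp only [eq_comm (b := r), Option.some.injEq]
    rw [sum_ite_eq_fst]
    simp
  constructor
  · refine (hroot s).trans ?_
    rw [Fintype.sum_eq_add_sum_compl i, hspecial,
      Finset.sum_congr rfl (g := fun _ => b / (d + 1))]
    · have : 1 ≤ m := i.pos
      simp [Finset.card_compl, this]
    · intro k hk
      have hk : k ≠ i := by simpa using hk
      rw [hparent _ (by simp [hk])]
      simp [hk.symm, div_eq_mul_inv]
  · refine (hroot !s).trans ?_
    rw [Finset.sum_congr rfl (g := fun _ => b / (d + 1))]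
    · simp
    · intro k _
      rw [hparent _ (by simp)]
      simp [div_eq_mul_inv]

theorem card_node : Fintype.card (Node m d) = 2 + (2 * m + 2 * m * d) := by
  simp [Fintype.card_sum]

/-! ### The PageRank gap and the size of the instances -/

theorem pageRank_hardGraph_gt {α η : ℝ} (h0 : 0 < α) (h1 : α < 1) (hη : 0 < η) {K t : ℕ}
    (hK : 3 * η < α ^ 2 * K) (ht : 1 ≤ t) (s : Bool) (i : Fin (2 * t ^ 2)) :
    pageRank α (hardGraph (2 * t ^ 2) (K * t) (some (s, i))) (node (.inl s))
      > (1 + η) * pageRank α (hardGraph (2 * t ^ 2) (K * t) (some (s, i))) (node (.inl !s)) := by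
  obtain ⟨b, hb, hu, hv⟩ := pageRank_hardGraph (d := K * t) h0 h1 s i
  rw [hu, hv]
  push_cast
  have ht' : (1 : ℝ) ≤ t := by exact_mod_cast ht
  have hK0 : 1 ≤ K := by
    rcases Nat.eq_zero_or_pos K with rfl | h
    · norm_num at hK; linarith
    · exact h
  have hK' : (1 : ℝ) ≤ K := by exact_mod_cast hK0
  set D : ℝ := (K : ℝ) * t + 1 with hD
  have hD1 : (t : ℝ) ≤ D := by nlinarith
  have hD0 : 0 < D := by linarith
  have hx : (2 * (t : ℝ) ^ 2) / D ≤ 2 * t := by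
    rw [div_le_iff₀ hD0]; nlinarith
  have hinv : 1 / D ≤ 1 := by rw [div_le_one hD0]; nlinarith
  -- The rank of the weaker root is at most `(1 + 2 * t) * b ≤ 3 * t * b`, whence the `3` in `hK`.
  have hmain : η * (1 + α * (2 * (t : ℝ) ^ 2 / D)) < α ^ 2 * (K * t) := by
    have e1 : α * (2 * (t : ℝ) ^ 2 / D) ≤ 2 * t := by
      have : 0 ≤ 2 * (t : ℝ) ^ 2 / D := by positivity
      nlinarith
    calc _ ≤ η * (3 * t) := by gcongr; linarith
      _ < _ := by nlinarith
  -- This expression is exactly the difference of the two sides of the goal.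
  have key : 0 < b * (α * (1 - 1 / D) + (α ^ 2 * (K * t)
      - η * (1 + α * (2 * (t : ℝ) ^ 2 / D)))) := by
    refine mul_pos hb (add_pos_of_nonneg_of_pos (mul_nonneg h0.le (by linarith)) (by linarith))
  rw [gt_iff_lt, ← sub_pos]
  refine key.trans_eq ?_
  field_simp
  ring

theorem card_node_rpow_le {K t : ℕ} (ht : 1 ≤ t) :
    (Fintype.card (Node (2 * t ^ 2) (K * t)) : ℝ) ^ (2 / 3 : ℝ) ≤ (6 + 4 * K) * t ^ 2 := by
  have ht' : (1 : ℝ) ≤ t := by exact_mod_cast ht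
  have hle : (Fintype.card (Node (2 * t ^ 2) (K * t)) : ℝ) ≤ (6 + 4 * K) * t ^ 3 := by
    rw [card_node]
    push_cast
    nlinarith [pow_le_pow_right₀ ht' (show 2 ≤ 3 by norm_num), one_le_pow₀ ht' (n := 3)]
  calc _ ≤ ((6 + 4 * K : ℝ) * t ^ 3) ^ (2 / 3 : ℝ) := by gcongr
    _ = (6 + 4 * K : ℝ) ^ (2 / 3 : ℝ) * t ^ 2 := by
      rw [Real.mul_rpow (by positivity) (by positivity), ← Real.rpow_natCast _ 3,
        ← Real.rpow_mul (by positivity), ← Real.rpow_natCast _ 2]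
      norm_num
    _ ≤ _ := by
      gcongr
      exact Real.rpow_le_self_of_one_le (by linarith [K.cast_nonneg (α := ℝ)]) (by norm_num)

end PageRankQueries

open PageRankQueries

/-! ### The lower bound -/

theorem theorem2 (α η : ℝ) (hα₀ : 0 < α) (hα₁ : α < 1) (hη : 0 < η) :
    ∃ c : ℝ → ℝ, (∀ δ > 0, 0 < c δ) ∧
      ∀ A : (n : ℕ) → PageRankQueries.MonteCarloAlgorithm n,
        ∀ N : ℕ, ∃ n ≥ N, ∃ (G : Digraph (Fin n)) (u v : Fin n),
          PageRankQueries.pageRank α G u > (1 + η) * PageRankQueries.pageRank α G v ∧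
          ∀ δ > 0, (A n).successProb G u v ≥ ENNReal.ofReal (1 / 2 + δ) →
            (A n).expectedQueries G u v ≥ ENNReal.ofReal (c δ * (n : ℝ) ^ (2 / 3 : ℝ)) := by
  obtain ⟨K, hK⟩ := exists_nat_gt (3 * η / α ^ 2)
  rw [div_lt_iff₀' (by positivity)] at hK
  have hL : (0 : ℝ) < 6 + 4 * K := by positivity
  -- The factor `6 + 4 * K` turns `n ^ (2 / 3)` into `t ^ 2`. The `4` keeps the query term, which
  -- has coefficient `2`, at half of the total advantage.
  refine ⟨fun δ => δ / (4 * (6 + 4 * K)), fun δ hδ => by positivity, fun A N => ?_⟩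
  set t := N + 1 with htdef
  have ht : 1 ≤ t := by omega
  set m := 2 * t ^ 2 with hm
  set d := K * t
  have hn := card_node_rpow_le (K := K) ht
  have hmt : N ≤ m := by nlinarith
  refine ⟨Fintype.card (Node m d), by rw [card_node]; omega, ?_⟩
  -- If every instance fails, each does so with its own `δ s i`; hence the averaging is over sums of
  -- these and not over one common advantage.
  by_contra! hcon
  choose δ hδ hsucc hquery using fun s i => hcon (hardGraph m d (some (s, i))) (node (.inl s))
    (node (.inl !s)) (pageRank_hardGraph_gt hα₀ hα₁ hη hK ht s i)
  have hq : ∀ s i, (A _).expectedQueries (hardGraph m d (some (s, i))) (node (.inl s))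
      (node (.inl !s)) < ENNReal.ofReal (δ s i * t ^ 2 / 4) := fun s i =>
    (hquery s i).trans_le <| ENNReal.ofReal_le_ofReal <| by
      have := hδ s i
      calc _ ≤ δ s i / (4 * (6 + 4 * K)) * ((6 + 4 * K) * t ^ 2) := by gcongr
        _ = _ := by field_simp
  have main := (A _).mul_sum_successProb_le (ι := Fin m) (G₀ := hardGraph m d none)
    (G := fun s i => hardGraph m d (some (s, i))) (fun s x i j hi hj => by
      obtain ⟨z, rfl⟩ := (Fintype.equivFin (Node m d)).surjective x
      have h1 := not_imp_comm.1 sameArcsAt_hardGraph hi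
      have h2 := not_imp_comm.1 sameArcsAt_hardGraph hj
      simpa using h1.symm.trans h2)
    (fun s => node (.inl s)) (fun h => by simpa using node_injective h) (t ^ 2) (by simp [hm])
  have hmpos : 0 < m := by positivity
  have hS : 0 < ∑ s, ∑ i : Fin m, δ s i := by
    have : Nonempty (Fin m) := ⟨⟨0, hmpos⟩⟩
    exact Finset.sum_pos (fun s _ => Finset.sum_pos (fun i _ => hδ s i) Finset.univ_nonempty)
      Finset.univ_nonempty
  have ofReal_sum_sum : ∀ f : Bool → Fin m → ℝ, (∀ s i, 0 ≤ f s i) →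
      ENNReal.ofReal (∑ s, ∑ i, f s i) = ∑ s, ∑ i, ENNReal.ofReal (f s i) := fun f hf => by
    rw [ENNReal.ofReal_sum_of_nonneg fun s _ => Finset.sum_nonneg fun i _ => hf s i]
    exact Finset.sum_congr rfl fun s _ => ENNReal.ofReal_sum_of_nonneg fun i _ => hf s i
  have hlow : ENNReal.ofReal (∑ s, ∑ i, (1 / 2 + δ s i))
      ≤ ∑ s, ∑ i : Fin m, (A _).successProb (hardGraph m d (some (s, i))) (node (.inl s))
        (node (.inl !s)) := by
    rw [ofReal_sum_sum _ fun s i => by linarith [hδ s i]]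
    exact Finset.sum_le_sum fun s _ => Finset.sum_le_sum fun i _ => hsucc s i
  have hup : ∑ s, ∑ i : Fin m, (A _).expectedQueries (hardGraph m d (some (s, i)))
        (node (.inl s)) (node (.inl !s))
      ≤ ENNReal.ofReal (∑ s, ∑ i, δ s i * t ^ 2 / 4) := by
    rw [ofReal_sum_sum _ fun s i => by have := hδ s i; positivity]
    exact Finset.sum_le_sum fun s _ => Finset.sum_le_sum fun i _ => (hq s i).le
  have hfin := ((mul_le_mul_right hlow _).trans main).trans
    (add_le_add_right (mul_le_mul_right hup 2) _)
  simp only [← Finset.sum_div, ← Finset.sum_mul, Finset.sum_add_distrib] at hfin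
  set S := ∑ s, ∑ i : Fin m, δ s i
  have e : (∑ _s : Bool, ∑ _i : Fin m, (1 : ℝ)) / 2 = 2 * t ^ 2 := by
    simp [hm]
  have ht0 : (0 : ℝ) < t := by positivity
  rw [e, ← ENNReal.ofReal_natCast, ← ENNReal.ofReal_mul (by positivity),
    ← ENNReal.ofReal_ofNat 2, ← ENNReal.ofReal_pow (by positivity),
    ← ENNReal.ofReal_mul (by positivity), ← ENNReal.ofReal_mul (by positivity),
    ← ENNReal.ofReal_add (by positivity) (by positivity),
    ENNReal.ofReal_le_ofReal_iff (by positivity)] at hfin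
  push_cast at hfin
  -- What remains is `t ^ 2 * (2 * t ^ 2 + S) ≤ 2 * t ^ 4 + t ^ 2 * S / 2`, impossible for `S > 0`.
  nlinarith [mul_pos (pow_pos ht0 2) hS]
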